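/- Let $G$ be a finite connected loopless multigraph with vertices $x_1,\dots,x_n$ and $m$ edges; let $e_{i,j}$ be the number of edges joining $x_i$ and $x_j$, and $d_i=\sum_j e_{i,j}$. A configuration is a vector $f\in\mathbb Z^n$, and its degree is $\sum_i f_i$. Let $L_G\subseteq\mathbb Z^n$ be the subgroup generated by the Laplacian configurations $\Delta^{(i)}=d_i\varepsilon^{(i)}-\sum_{j}e_{i,j}\varepsilon^{(j)}$ ($1\le i\le n$), where $\varepsilon^{(1)},\dots,\varepsilon^{(n)}$ is the standard basis of $\mathbb Z^n$. Two configurations $f,g$ are (toppling) equivalent if $f-g\in L_G$. A configuration is effective if all its values are nonnegative, and $L_G$-effective if it is equivalent to an effective configuration. Let $T_G(x,y)=\sum_{A\subseteq E(G)}(x-1)^{k(A)-k(E(G))}(y-1)^{k(A)+|A|-n}$ be the Tutte polynomial of $G$, where $E(G)$ is the set of edges of $G$ and $k(A)$ is the number of connected components of the spanning subgraph of $G$ with edge set $A$. Then $T_G(1,y)$ has degree at most $m-n+1$, so that $$T_G(1,y)=\sum_{i=0}^{m-n+1}t_i\,y^i$$ with integer coefficients $t_i$. Put $t_k=0$ for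 $k<0$. For every integer $d$, the number of equivalence classes of $L_G$-effective configurations of degree $d$ is finite and equal to $$\sum_{k=m-n+1-d}^{m-n+1}t_k ,$$ where the sum is empty, hence $0$, if $d<0$. -/

import Mathlib

open Polynomial

noncomputable section

namespace Graph

/-! Throughout, `G : Graph α β` is a multigraph with finitely many vertices and edges. -/

/-- `G` is connected: it has a vertex, and any two of its vertices are joined by a path. -/
def IsConnectedGraph {α β : Type*} (G : Graph α β) : Prop :=
  G.vertexSet.Nonempty ∧
    ∀ x ∈ G.vertexSet, ∀ y ∈ G.vertexSet, Relation.ReflTransGen G.Adj x y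

/-- The number `n` of vertices. -/
def numVertices {α β : Type*} (G : Graph α β) : ℕ := G.vertexSet.ncard

/-- The number `m` of edges. -/
def numEdges {α β : Type*} (G : Graph α β) : ℕ := G.edgeSet.ncard

/-- The number `e_{x,y}` of edges with endpoints `x` and `y`. -/
def edgeCount {α β : Type*} (G : Graph α β) (x y : α) : ℕ := {e | G.IsLink e x y}.ncard

/-- The number of connected components of the spanning subgraph `(V(G), A)` of `G`
(`Quot` divides by the equivalence relation generated by being joined by an edge of `A`). -/
def componentCount {α β : Type*} (G : Graph α β) (A : Set β) : ℕ :=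
  Nat.card (Quot fun x y : G.vertexSet => ∃ e ∈ A, G.IsLink e x y)

/-- The Tutte polynomial, in the variables `x = X 0` and `y = X 1`:
`T_G(x,y) = ∑_{A ⊆ E(G)} (x-1)^(k(A)-k(E(G))) (y-1)^(k(A)+|A|-n)`, where `k(A)` is the number of
connected components of `(V(G), A)`. Both exponents are nonnegative for every `A ⊆ E(G)`, so the
subtractions of natural numbers are never truncated. -/
def tuttePolynomial {α β : Type*} (G : Graph α β) [Finite G.edgeSet] : MvPolynomial (Fin 2) ℤ :=
  ∑ A ∈ (Set.toFinite G.edgeSet).toFinset.powerset,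
    (MvPolynomial.X 0 - 1) ^ (G.componentCount (A : Set β) - G.componentCount G.edgeSet) *
      (MvPolynomial.X 1 - 1) ^ (G.componentCount (A : Set β) + A.card - G.numVertices)

/-- The univariate polynomial `T_G(1,y)`. -/
def tutteAtOne {α β : Type*} (G : Graph α β) [Finite G.edgeSet] : ℤ[X] :=
  MvPolynomial.aeval ![(1 : ℤ[X]), (X : ℤ[X])] G.tuttePolynomial

/-- The coefficient `t_k` of `y^k` in `T_G(1,y)`, for an integer `k`; it is `0` for `k < 0`. -/
def tutteCoeff {α β : Type*} (G : Graph α β) [Finite G.edgeSet] (k : ℤ) : ℤ :=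
  if 0 ≤ k then G.tutteAtOne.coeff k.toNat else 0

/-- A configuration assigns an integer to each vertex. -/
abbrev Configuration {α β : Type*} (G : Graph α β) : Type _ := G.vertexSet → ℤ

/-- The degree of a configuration is the sum of its values. -/
def configDegree {α β : Type*} (G : Graph α β) [Fintype G.vertexSet] (f : G.Configuration) : ℤ :=
  ∑ x, f x

open Classical in
/-- The Laplacian configuration `Δ^(x) = d_x ε^(x) - ∑_y e_{x,y} ε^(y)`, where
`d_x = ∑_y e_{x,y}` and `ε^(y)` is `1` at `y` and `0` elsewhere. -/
def laplacianConfig {α β : Type*} (G : Graph α β) [Fintype G.vertexSet] (x : G.vertexSet) :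
    G.Configuration :=
  (∑ y : G.vertexSet, (G.edgeCount x y : ℤ)) • (Pi.single x 1 : G.Configuration) -
    ∑ y : G.vertexSet, (G.edgeCount x y : ℤ) • (Pi.single y 1 : G.Configuration)

/-- The subgroup `L_G` of the group of configurations generated by the Laplacian configurations. -/
def laplacianLattice {α β : Type*} (G : Graph α β) [Fintype G.vertexSet] :
    AddSubgroup G.Configuration :=
  AddSubgroup.closure (Set.range G.laplacianConfig)

/-- Toppling equivalence: `f ∼ g` if and only if `f - g ∈ L_G`. -/
def topplingSetoid {α β : Type*} (G : Graph α β) [Fintype G.vertexSet] :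
    Setoid G.Configuration where
  r f g := f - g ∈ G.laplacianLattice
  iseqv :=
    { refl := fun f => by simp
      symm := fun {f g} h => by simpa using G.laplacianLattice.neg_mem h
      trans := fun {f g k} h₁ h₂ => by simpa using G.laplacianLattice.add_mem h₁ h₂ }

/-- A configuration is effective if all its values are nonnegative. -/
def IsEffective {α β : Type*} (G : Graph α β) (f : G.Configuration) : Prop := ∀ x, 0 ≤ f x

/-- A configuration is `L_G`-effective if it is toppling equivalent to an effective one. -/
def IsLatticeEffective {α β : Type*} (G : Graph α β) [Fintype G.vertexSet]
    (f : G.Configuration) : Prop :=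
  ∃ g : G.Configuration, G.IsEffective g ∧ G.topplingSetoid f g

/-- The toppling equivalence classes of the `L_G`-effective configurations of degree `d`. -/
def effectiveClasses {α β : Type*} (G : Graph α β) [Fintype G.vertexSet] (d : ℤ) :
    Set (Quotient G.topplingSetoid) :=
  {c | ∃ f : G.Configuration,
    G.IsLatticeEffective f ∧ G.configDegree f = d ∧ Quotient.mk G.topplingSetoid f = c}

end Graph

end

/-! ### Superstable configurations and deletion–contraction -/

noncomputable section

namespace Graph

variable {α β : Type*} {G : Graph α β}

/-! Fix a vertex `q` as sink. A configuration that is nonnegative off `q` is superstable if no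
nonempty set of non-sink vertices can fire all at once without making one of its members negative.
Two counts meet in these objects.

Each class of effective configurations of degree `d` contains exactly one configuration that is
superstable off `q`, and its value at `q` is then nonnegative. So these classes correspond to the
superstable `c` with `∑ c ≤ d` (`bijOn_effectiveClasses`). Existence comes from firing sets until
none can fire; uniqueness and the sign at `q` come from the maximum principle
`IsSuperstable.le_sink`.

By Merino's theorem (`tutteAtOne_eq_sum`), `t_k` is the number of superstable `c` with `∑ c = m - n
+ 1 - k`. It follows from the deletion–contraction identity `sum_isSuperstable_eq`, stated for an
arbitrary set of sinks so that contracting an edge just enlarges that set.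

Summing `t_k` over `k ≥ m - n + 1 - d` therefore counts the superstable `c` of degree at most `d`.
-/

open Classical in
/-- The number of edges of `R` joining the vertex `u` to a vertex outside `W`. -/
def outCount (G : Graph α β) (R : Finset β) (W : Set G.vertexSet) (u : G.vertexSet) : ℕ :=
  (R.filter fun e => ∃ x, x ∉ W ∧ G.IsLink e u x).card

/-- `c` is superstable with respect to the edges in `R` and the set of sinks `B`. -/
structure IsSuperstable (G : Graph α β) (R : Finset β) (B : Finset G.vertexSet)
    (c : G.vertexSet → ℕ) : Prop where
  eq_zero : ∀ x ∈ B, c x = 0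
  exists_lt : ∀ W : Set G.vertexSet, W.Nonempty → (∀ x ∈ W, x ∉ B) →
    ∃ u ∈ W, c u < G.outCount R W u

lemma outCount_pos_iff {R : Finset β} {W : Set G.vertexSet} {u : G.vertexSet} :
    0 < G.outCount R W u ↔ ∃ e ∈ R, ∃ x : G.vertexSet, x ∉ W ∧ G.IsLink e u x := by
  simp [outCount, Finset.card_pos, Finset.Nonempty]

open Classical in
lemma outCount_insert_of_not_isLink {R : Finset β} {W : Set G.vertexSet} {u : G.vertexSet} {e : β}
    (h : ∀ x : G.vertexSet, x ∉ W → ¬ G.IsLink e u x) :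
    G.outCount (insert e R) W u = G.outCount R W u := by
  unfold outCount
  rw [Finset.filter_insert, if_neg]
  rintro ⟨x, hx, hl⟩
  exact h x hx hl

open Classical in
lemma outCount_insert_of_isLink {R : Finset β} {W : Set G.vertexSet} {u x : G.vertexSet} {e : β}
    (he : e ∉ R) (hx : x ∉ W) (h : G.IsLink e u x) :
    G.outCount (insert e R) W u = G.outCount R W u + 1 := by
  unfold outCount
  rw [Finset.filter_insert, if_pos ⟨x, hx, h⟩, Finset.card_insert_of_notMem (by simp [he])]

open Classical in
/-- Contracting an edge `e` from the sinks to a vertex `v` where `c` vanishes. -/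
lemma isSuperstable_insert_iff_contract {R : Finset β} {B : Finset G.vertexSet}
    {c : G.vertexSet → ℕ} {e : β} {b v : G.vertexSet} (hb : b ∈ B) (hl : G.IsLink e b v)
    (hc : c v = 0) :
    G.IsSuperstable (insert e R) B c ↔ G.IsSuperstable R (insert v B) c := by
  have key : ∀ W : Set G.vertexSet, (∀ x ∈ W, x ∉ insert v B) → ∀ u ∈ W,
      G.outCount (insert e R) W u = G.outCount R W u := by
    intro W hW u hu
    refine outCount_insert_of_not_isLink fun x _ hx => ?_
    have := hW u hu
    rcases hx.left_eq_or_eq hl with h | h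
    · exact this (Finset.mem_insert_of_mem (by rwa [Subtype.ext h]))
    · exact this (by rw [Subtype.ext h]; exact Finset.mem_insert_self _ _)
  constructor
  · rintro ⟨h0, h1⟩
    refine ⟨fun x hx => ?_, fun W hW hWB => ?_⟩
    · rcases Finset.mem_insert.1 hx with rfl | hx
      exacts [hc, h0 x hx]
    · obtain ⟨u, hu, h⟩ := h1 W hW fun x hx hxB => hWB x hx (Finset.mem_insert_of_mem hxB)
      exact ⟨u, hu, by rwa [← key W hWB u hu]⟩
  · rintro ⟨h0, h1⟩
    refine ⟨fun x hx => h0 x (Finset.mem_insert_of_mem hx), fun W hW hWB => ?_⟩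
    -- If `v ∈ W`, then `v` itself is the witness, because `e` leaves `W` and `c v = 0`. Otherwise
    -- both ends of `e` lie outside `W`, and `e` plays no role.
    by_cases hv : v ∈ W
    · refine ⟨v, hv, ?_⟩
      rw [hc, outCount_pos_iff]
      exact ⟨e, Finset.mem_insert_self _ _, b, fun h => hWB b h hb, hl.symm⟩
    · have hW' : ∀ x ∈ W, x ∉ insert v B := by
        intro x hx hxB
        rcases Finset.mem_insert.1 hxB with rfl | hxB
        exacts [hv hx, hWB x hx hxB]
      obtain ⟨u, hu, h⟩ := h1 W hW hW'
      exact ⟨u, hu, by rwa [key W hW' u hu]⟩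

open Classical in
/-- Deleting an edge `e` from the sinks to a vertex `v` where the configuration is positive. -/
lemma isSuperstable_insert_iff_delete {R : Finset β} {B : Finset G.vertexSet}
    {c : G.vertexSet → ℕ} {e : β} {b v : G.vertexSet} (he : e ∉ R) (hb : b ∈ B) (hv : v ∉ B)
    (hl : G.IsLink e b v) :
    G.IsSuperstable (insert e R) B (c + Pi.single v 1) ↔ G.IsSuperstable R B c := by
  have key : ∀ W : Set G.vertexSet, (∀ x ∈ W, x ∉ B) → ∀ u ∈ W,
      ((c + Pi.single v 1 : G.vertexSet → ℕ) u < G.outCount (insert e R) W u ↔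
        c u < G.outCount R W u) := by
    intro W hW u hu
    by_cases huv : u = v
    · subst huv
      rw [outCount_insert_of_isLink he (fun h => hW b h hb) hl.symm]
      simp
    · rw [outCount_insert_of_not_isLink fun x _ hx => ?_]
      · simp [huv]
      rcases hx.left_eq_or_eq hl with h | h
      · exact hW u hu (by rwa [Subtype.ext h])
      · exact huv (Subtype.ext h)
  have hz : ∀ x ∈ B, (c + Pi.single v 1 : G.vertexSet → ℕ) x = c x := by
    intro x hx
    have : x ≠ v := by rintro rfl; exact hv hx
    simp [this]
  constructor
  · rintro ⟨h0, h1⟩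
    refine ⟨fun x hx => by rw [← hz x hx, h0 x hx], fun W hW hWB => ?_⟩
    obtain ⟨u, hu, h⟩ := h1 W hW hWB
    exact ⟨u, hu, (key W hWB u hu).1 h⟩
  · rintro ⟨h0, h1⟩
    refine ⟨fun x hx => by rw [hz x hx, h0 x hx], fun W hW hWB => ?_⟩
    obtain ⟨u, hu, h⟩ := h1 W hW hWB
    exact ⟨u, hu, (key W hWB u hu).2 h⟩

variable [Fintype G.vertexSet]

/-- Supplies the edge for the deletion–contraction inductions: the whole complement of `B` cannot
fire, so some edge leaves it. -/
lemma IsSuperstable.exists_isLink {R : Finset β} {B : Finset G.vertexSet}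
    {c : G.vertexSet → ℕ} (h : G.IsSuperstable R B c) (hB : B ≠ Finset.univ) :
    ∃ e ∈ R, ∃ b ∈ B, ∃ v ∉ B, G.IsLink e b v := by
  obtain ⟨w, hw⟩ : ∃ w, w ∉ B := by
    by_contra! h'
    exact hB (Finset.eq_univ_iff_forall.2 h')
  obtain ⟨u, hu, hlt⟩ := h.exists_lt {x | x ∉ B} ⟨w, hw⟩ fun x hx => hx
  obtain ⟨e, he, x, hx, hl⟩ := outCount_pos_iff.1 (Nat.zero_lt_of_lt hlt)
  exact ⟨e, he, x, by simpa using hx, u, hu, hl.symm⟩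

lemma sub_single_add_single {ι : Type*} [DecidableEq ι] {c : ι → ℕ} {v : ι} (h : c v ≠ 0) :
    c - Pi.single v 1 + Pi.single v 1 = c := by
  funext x
  by_cases hx : x = v
  · subst hx
    simp
    omega
  · simp [hx]

open Classical in
lemma card_compl_insert {B : Finset G.vertexSet} {v : G.vertexSet} (hv : v ∉ B) :
    (insert v B)ᶜ.card + 1 = Bᶜ.card := by
  rw [Finset.compl_insert, Finset.card_erase_add_one (by simpa using hv)]

-- Each step spends one edge: contraction removes one non-sink vertex, deletion lowers `∑ c` by one.
open Classical in
lemma IsSuperstable.card_add_sum_le {R : Finset β} {B : Finset G.vertexSet}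
    {c : G.vertexSet → ℕ} (h : G.IsSuperstable R B c) : Bᶜ.card + ∑ x, c x ≤ R.card := by
  induction hn : R.card generalizing R B c with
  | zero =>
    by_cases hB : B = Finset.univ
    · subst hB
      simp [h.eq_zero]
    · obtain ⟨e, he, -⟩ := h.exists_isLink hB
      simp [Finset.card_eq_zero.1 hn] at he
  | succ n ih =>
    by_cases hB : B = Finset.univ
    · subst hB
      simp [h.eq_zero]
    · obtain ⟨e, he, b, hb, v, hv, hl⟩ := h.exists_isLink hB
      obtain ⟨R, heR, rfl⟩ : ∃ R', e ∉ R' ∧ R = insert e R' :=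
        ⟨R.erase e, by simp, (Finset.insert_erase he).symm⟩
      rw [Finset.card_insert_of_notMem heR, Nat.add_right_cancel_iff] at hn
      by_cases hc : c v = 0
      · have := ih ((isSuperstable_insert_iff_contract hb hl hc).1 h) hn
        have := card_compl_insert hv
        omega
      · rw [← sub_single_add_single hc] at h
        have := ih ((isSuperstable_insert_iff_delete heR hb hv hl).1 h) hn
        rw [← sub_single_add_single hc]
        simp only [Pi.add_apply, Finset.sum_add_distrib, Finset.sum_pi_single', Finset.mem_univ,
          if_true]
        omega

open Classical in
lemma isSuperstable_univ_iff {R : Finset β} {c : G.vertexSet → ℕ} :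
    G.IsSuperstable R Finset.univ c ↔ c = 0 := by
  refine ⟨fun h => funext fun x => h.eq_zero x (Finset.mem_univ x), ?_⟩
  rintro rfl
  exact ⟨fun _ _ => rfl, fun W ⟨x, hx⟩ h => absurd (Finset.mem_univ x) (h x hx)⟩

open Classical in
/-- The generating function of superstable configurations by level enumerates, after the shift
`y = z + 1`, the edge sets joining every vertex to a sink. -/
theorem sum_isSuperstable_eq {K : Type*} [CommRing K] (z : K) {R : Finset β}
    {B : Finset G.vertexSet} {S : Finset (G.vertexSet → ℕ)}
    (hS : ∀ c, c ∈ S ↔ G.IsSuperstable R B c) :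
    z ^ Bᶜ.card * ∑ c ∈ S, (z + 1) ^ (R.card - Bᶜ.card - ∑ x, c x) =
      ∑ A ∈ R.powerset, if G.IsSuperstable A B 0 then z ^ A.card else 0 := by
  induction hn : R.card using Nat.strong_induction_on generalizing R B S with
  | _ n ih =>
  subst hn
  obtain rfl | hB := eq_or_ne B Finset.univ
  · obtain rfl : S = {0} := by
      ext c
      rw [hS, isSuperstable_univ_iff, Finset.mem_singleton]
    have := Finset.sum_pow_mul_eq_add_pow z 1 R
    simp only [one_pow, mul_one] at this
    simp [isSuperstable_univ_iff, this]
  -- Without an edge leaving the sinks, no configuration is superstable and both sides vanish.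
  by_cases hex : ∃ e ∈ R, ∃ b ∈ B, ∃ v ∉ B, G.IsLink e b v
  swap
  · obtain rfl : S = ∅ :=
      Finset.eq_empty_of_forall_notMem fun c hc => hex (((hS c).1 hc).exists_isLink hB)
    rw [Finset.sum_empty, mul_zero, eq_comm]
    refine Finset.sum_eq_zero fun A hA => if_neg fun h => hex ?_
    obtain ⟨e, he, h⟩ := h.exists_isLink hB
    exact ⟨e, Finset.mem_powerset.1 hA he, h⟩
  obtain ⟨e, he, b, hb, v, hv, hl⟩ := hex
  obtain ⟨R, heR, rfl⟩ : ∃ R', e ∉ R' ∧ R = insert e R' :=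
    ⟨R.erase e, by simp, (Finset.insert_erase he).symm⟩
  have hcard := Finset.card_insert_of_notMem heR
  have hcompl := card_compl_insert hv
  have h1 := ih R.card (by omega) (R := R) (B := insert v B) (S := {c ∈ S | c v = 0})
    (fun c => by
      rw [Finset.mem_filter, hS]
      constructor
      · exact fun h => (isSuperstable_insert_iff_contract hb hl h.2).1 h.1
      · intro h
        have hc := h.eq_zero v (Finset.mem_insert_self _ _)
        exact ⟨(isSuperstable_insert_iff_contract hb hl hc).2 h, hc⟩) rfl
  have hinj : Set.InjOn (fun c : G.vertexSet → ℕ => c - Pi.single v 1)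
      (S.filter fun c => ¬ c v = 0 : Finset _) := by
    intro c hc c' hc' h
    simp only [Finset.coe_filter, Set.mem_ofPred_eq] at hc hc'
    rw [← sub_single_add_single hc.2, ← sub_single_add_single hc'.2]
    exact congrArg (· + Pi.single v 1) h
  have h2 := ih R.card (by omega) (R := R) (B := B)
    (S := {c ∈ S | ¬ c v = 0}.image fun c => c - Pi.single v 1)
    (fun c => by
      simp only [Finset.mem_image, Finset.mem_filter, hS]
      constructor
      · rintro ⟨c, ⟨h, hc⟩, rfl⟩
        rw [← sub_single_add_single hc] at h
        exact (isSuperstable_insert_iff_delete heR hb hv hl).1 h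
      · intro h
        exact ⟨c + Pi.single v 1, ⟨(isSuperstable_insert_iff_delete heR hb hv hl).2 h, by simp⟩,
          by simp⟩) rfl
  rw [Finset.sum_image hinj] at h2
  -- The `c` with `c v ≠ 0` match the `A` avoiding `e` (deletion), and those with `c v = 0` match
  -- the `A` containing `e` (contraction), where the weight of `e` supplies the additional factor
  -- `z`.
  rw [Finset.sum_powerset_insert heR, ← h2, ← Finset.sum_filter_add_sum_filter_not S (fun c => c v = 0),
    mul_add, add_comm]
  congr 1
  · congr 1
    refine Finset.sum_congr rfl fun c hc => ?_
    congr 1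
    have : ∑ x, c x = ∑ x, (c - Pi.single v 1 : G.vertexSet → ℕ) x + 1 := by
      conv_lhs => rw [← sub_single_add_single (Finset.mem_filter.1 hc).2]
      simp only [Pi.add_apply, Finset.sum_add_distrib, Finset.sum_pi_single', Finset.mem_univ,
        if_true]
    omega
  · have h3 : ∀ A ∈ R.powerset,
        (if G.IsSuperstable (insert e A) B 0 then z ^ (insert e A).card else 0) =
          z * if G.IsSuperstable A (insert v B) 0 then z ^ A.card else 0 := by
      intro A hA
      rw [isSuperstable_insert_iff_contract hb hl rfl,
        Finset.card_insert_of_notMem fun h => heR (Finset.mem_powerset.1 hA h), mul_ite, mul_zero,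
        pow_succ']
    rw [Finset.sum_congr rfl h3, ← Finset.mul_sum, ← h1, ← hcompl, pow_succ', mul_assoc]
    congr 2
    refine Finset.sum_congr rfl fun c _ => ?_
    congr 1
    omega

end Graph
end

/-! ### The Laplacian lattice as the image of toppling vectors -/

noncomputable section

namespace Graph

variable {α β : Type*} {G : Graph α β}

lemma edgeCount_comm (x y : α) : G.edgeCount x y = G.edgeCount y x := by
  simp only [edgeCount, isLink_comm]

/-- The finite set of all edges of `G`. -/
def edges (G : Graph α β) [Finite G.edgeSet] : Finset β := (Set.toFinite G.edgeSet).toFinset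

@[simp]
lemma mem_edges [Finite G.edgeSet] {e : β} : e ∈ G.edges ↔ e ∈ G.edgeSet := by simp [edges]

lemma card_edges [Finite G.edgeSet] : G.edges.card = G.numEdges :=
  (Set.ncard_eq_toFinset_card _ _).symm

variable [Fintype G.vertexSet]

/-- The combination of the Laplacian configurations with coefficients `σ`. -/
def topple (G : Graph α β) [Fintype G.vertexSet] (σ : G.vertexSet → ℤ) : G.Configuration :=
  fun y => ∑ x : G.vertexSet, (G.edgeCount y x : ℤ) * (σ y - σ x)

lemma topple_sub (σ τ : G.vertexSet → ℤ) : G.topple (σ - τ) = G.topple σ - G.topple τ := by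
  funext y
  simp only [topple, Pi.sub_apply, ← Finset.sum_sub_distrib]
  exact Finset.sum_congr rfl fun x _ => by ring

lemma topple_add (σ τ : G.vertexSet → ℤ) : G.topple (σ + τ) = G.topple σ + G.topple τ := by
  funext y
  simp only [topple, Pi.add_apply, ← Finset.sum_add_distrib]
  exact Finset.sum_congr rfl fun x _ => by ring

lemma topple_zero : G.topple 0 = 0 := by
  funext y
  simp [topple]

lemma topple_neg (σ : G.vertexSet → ℤ) : G.topple (-σ) = -G.topple σ := by
  rw [← zero_sub, topple_sub, topple_zero, zero_sub]

lemma sum_smul_laplacianConfig (σ : G.vertexSet → ℤ) :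
    ∑ x, σ x • G.laplacianConfig x = G.topple σ := by
  classical
  funext y
  simp only [topple, laplacianConfig, Finset.sum_apply, Pi.smul_apply, Pi.sub_apply,
    Pi.single_apply, smul_eq_mul, mul_ite, mul_one, mul_zero, mul_sub, Finset.sum_sub_distrib,
    Finset.sum_ite_eq, Finset.mem_univ, if_true]
  rw [← Finset.sum_mul, mul_comm]
  congr 1
  exact Finset.sum_congr rfl fun x _ => by rw [edgeCount_comm, mul_comm]

lemma mem_laplacianLattice_iff {f : G.Configuration} :
    f ∈ G.laplacianLattice ↔ ∃ σ, f = G.topple σ := by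
  rw [laplacianLattice, AddSubgroup.mem_closure_range_iff_of_fintype]
  simp only [sum_smul_laplacianConfig]

lemma sum_topple (σ : G.vertexSet → ℤ) : ∑ x, G.topple σ x = 0 := by
  have h : ∑ y : G.vertexSet, ∑ x : G.vertexSet, (G.edgeCount y x : ℤ) * σ x =
      ∑ y : G.vertexSet, ∑ x : G.vertexSet, (G.edgeCount y x : ℤ) * σ y := by
    rw [Finset.sum_comm]
    exact Finset.sum_congr rfl fun x _ => Finset.sum_congr rfl fun y _ => by rw [edgeCount_comm]
  simp only [topple, mul_sub, Finset.sum_sub_distrib, h, sub_self]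

lemma configDegree_eq_of_equiv {f g : G.Configuration} (h : G.topplingSetoid f g) :
    G.configDegree f = G.configDegree g := by
  obtain ⟨σ, hσ⟩ := mem_laplacianLattice_iff.1 (show f - g ∈ G.laplacianLattice from h)
  rw [eq_add_of_sub_eq hσ]
  simp [configDegree, Finset.sum_add_distrib, sum_topple]

lemma topple_eq_zero_of_const {σ : G.vertexSet → ℤ} {a : ℤ} (h : ∀ x, σ x = a) :
    G.topple σ = 0 := by
  funext y
  simp [topple, h]

open Classical in
/-- The configuration with values `c` off the sink `q` and of degree `d`, for `c` vanishing
at `q`. -/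
def withDegree (G : Graph α β) [Fintype G.vertexSet] (q : G.vertexSet) (d : ℤ)
    (c : G.vertexSet → ℕ) : G.Configuration :=
  fun x => c x + if x = q then d - ∑ y, (c y : ℤ) else 0

lemma configDegree_withDegree (q : G.vertexSet) (d : ℤ) (c : G.vertexSet → ℕ) :
    G.configDegree (G.withDegree q d c) = d := by
  classical
  simp [configDegree, withDegree, Finset.sum_add_distrib]

lemma finite_isEffective (d : ℤ) :
    {f : G.Configuration | G.IsEffective f ∧ G.configDegree f = d}.Finite := by
  classical
  refine (Set.finite_Icc (0 : G.Configuration) (fun _ => d)).subset ?_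
  rintro f ⟨hf, rfl⟩
  exact ⟨hf, fun x => Finset.single_le_sum (fun y _ => hf y) (Finset.mem_univ x)⟩

/-! ### Maximum principle and superstable representatives -/

variable [Finite G.edgeSet]

open Classical in
lemma outCount_edges (W : Set G.vertexSet) (u : G.vertexSet) :
    G.outCount G.edges W u = ∑ x, if x ∈ W then 0 else G.edgeCount u x := by
  have hcard : ∀ x : G.vertexSet,
      G.edgeCount u x = (G.edges.filter fun e => G.IsLink e u x).card := by
    intro x
    rw [edgeCount, ← Set.ncard_coe_finset]
    congr 1
    ext e
    simpa using fun h : G.IsLink e u x => h.edge_mem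
  have hunion : G.outCount G.edges W u = ((Finset.univ.filter (· ∉ W)).biUnion
      fun x : G.vertexSet => G.edges.filter fun e => G.IsLink e u x).card := by
    unfold outCount
    congr 1
    ext e
    simp only [Finset.mem_filter, Finset.mem_biUnion, Finset.mem_univ, true_and]
    tauto
  rw [hunion, Finset.card_biUnion]
  · simp only [← hcard, Finset.sum_filter, ite_not]
  · intro x _ y _ hxy
    refine Finset.disjoint_left.2 fun e hx hy => hxy (Subtype.ext ?_)
    exact (Finset.mem_filter.1 hx).2.right_unique (Finset.mem_filter.1 hy).2

/-- Every edge from `u` out of `W` contributes at least one to `topple σ u`, and no edge contributes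
negatively. -/
lemma outCount_le_topple {σ : G.vertexSet → ℤ} {W : Set G.vertexSet} {u : G.vertexSet}
    (hle : ∀ x, σ x ≤ σ u) (hlt : ∀ x, x ∉ W → σ x < σ u) :
    (G.outCount G.edges W u : ℤ) ≤ G.topple σ u := by
  classical
  rw [outCount_edges, topple, Nat.cast_sum]
  refine Finset.sum_le_sum fun x _ => ?_
  split_ifs with hx
  · exact mul_nonneg (by positivity) (sub_nonneg.2 (hle x))
  · exact le_mul_of_one_le_right (by positivity) (by have := hlt x hx; omega)

open Classical in
lemma topple_indicator_le (W : Set G.vertexSet) (u : G.vertexSet) :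
    G.topple (fun x => if x ∈ W then 1 else 0) u ≤
      if u ∈ W then (G.outCount G.edges W u : ℤ) else 0 := by
  split_ifs with hu
  · rw [outCount_edges, topple, Nat.cast_sum]
    refine Finset.sum_le_sum fun x _ => ?_
    by_cases hx : x ∈ W <;> simp [hx, hu]
  · refine Finset.sum_nonpos fun x _ => ?_
    by_cases hx : x ∈ W <;> simp [hx, hu]

/-- Maximum principle: if a superstable configuration is obtained from one that is nonnegative
off the sink, then the toppling vector is maximal at the sink. -/
lemma IsSuperstable.le_sink {q : G.vertexSet} {c : G.vertexSet → ℕ}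
    (h : G.IsSuperstable G.edges {q} c) {f g : G.Configuration} {σ : G.vertexSet → ℤ}
    (hf : ∀ x, x ≠ q → f x = c x) (hg : ∀ x, x ≠ q → 0 ≤ g x) (hfg : f = g + G.topple σ)
    (x : G.vertexSet) : σ x ≤ σ q := by
  have : Nonempty G.vertexSet := ⟨q⟩
  obtain ⟨w, hw⟩ := Finite.exists_max σ
  by_contra! hx
  have hq : ∀ y ∈ {y | σ y = σ w}, y ∉ ({q} : Finset G.vertexSet) := by
    intro y hy hyq
    rw [Finset.mem_singleton.1 hyq] at hy
    have : σ q = σ w := hy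
    have := hw x
    omega
  -- If the set where `σ` is maximal misses `q`, superstability gives a `u` in it with `c u <
  -- outCount ≤ topple σ u`, although `c u = g u + topple σ u` with `g u ≥ 0`.
  obtain ⟨u, hu, hlt⟩ := h.exists_lt {y | σ y = σ w} ⟨w, rfl⟩ hq
  have huq : u ≠ q := by simpa using hq u hu
  have hu' : σ u = σ w := hu
  have h1 := outCount_le_topple (W := {y | σ y = σ w}) (u := u) (fun y => hu' ▸ hw y)
    (fun y hy => hu' ▸ lt_of_le_of_ne (hw y) hy)
  have h2 := hf u huq
  have h3 := hg u huq
  rw [hfg, Pi.add_apply] at h2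
  omega

/-- Superstability of `0` encodes connectedness; the maximum principle for `σ - τ` and its negative
shows that the difference is constant. -/
lemma eq_of_topple_eq {q : G.vertexSet} (hG : G.IsSuperstable G.edges {q} 0)
    {σ τ : G.vertexSet → ℤ} (h : G.topple σ = G.topple τ) (hq : σ q = τ q) : σ = τ := by
  have h1 := hG.le_sink (f := 0) (g := 0) (σ := σ - τ) (by simp) (by simp)
    (by simp [topple_sub, h])
  have h2 := hG.le_sink (f := 0) (g := 0) (σ := τ - σ) (by simp) (by simp)
    (by simp [topple_sub, h])
  funext x
  have := h1 x
  have := h2 x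
  simp only [Pi.sub_apply] at *
  omega

/-- Applied in both directions, the maximum principle makes `σ` both maximal and minimal at `q`,
hence constant. -/
lemma IsSuperstable.eq_of_equiv {q : G.vertexSet} {c c' : G.vertexSet → ℕ} {d : ℤ}
    (h : G.IsSuperstable G.edges {q} c) (h' : G.IsSuperstable G.edges {q} c')
    (he : G.topplingSetoid (G.withDegree q d c) (G.withDegree q d c')) : c = c' := by
  obtain ⟨σ, hσ⟩ := mem_laplacianLattice_iff.1
    (show G.withDegree q d c - G.withDegree q d c' ∈ G.laplacianLattice from he)
  have h1 := h.le_sink (f := G.withDegree q d c) (g := G.withDegree q d c') (σ := σ)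
    (fun x hx => by simp [withDegree, hx]) (fun x hx => by simp [withDegree, hx])
    (by rw [← hσ]; abel)
  have h2 := h'.le_sink (f := G.withDegree q d c') (g := G.withDegree q d c) (σ := -σ)
    (fun x hx => by simp [withDegree, hx]) (fun x hx => by simp [withDegree, hx])
    (by rw [topple_neg, ← hσ]; abel)
  rw [topple_eq_zero_of_const (a := σ q) fun x => ?_, sub_eq_zero] at hσ
  · funext x
    by_cases hx : x = q
    · rw [hx, h.eq_zero q (by simp), h'.eq_zero q (by simp)]
    · simpa [withDegree, hx] using congrFun hσ x
  · have := h1 x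
    have := h2 x
    simp only [Pi.neg_apply] at *
    omega

/-- Since `σ` is maximal at `q`, the superstable representative has at `q` at least the value of any
equivalent effective configuration. -/
lemma IsSuperstable.isLatticeEffective_iff {q : G.vertexSet} {c : G.vertexSet → ℕ} {d : ℤ}
    (h : G.IsSuperstable G.edges {q} c) :
    G.IsLatticeEffective (G.withDegree q d c) ↔ ∑ x, (c x : ℤ) ≤ d := by
  have hcq := h.eq_zero q (by simp)
  constructor
  · rintro ⟨g, hg, he⟩
    obtain ⟨σ, hσ⟩ := mem_laplacianLattice_iff.1
      (show G.withDegree q d c - g ∈ G.laplacianLattice from he)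
    have h1 := h.le_sink (f := G.withDegree q d c) (g := g) (σ := σ)
      (fun x hx => by simp [withDegree, hx]) (fun x _ => hg x) (by rw [← hσ]; abel)
    have h2 : 0 ≤ G.topple σ q :=
      Finset.sum_nonneg fun x _ => mul_nonneg (by positivity) (sub_nonneg.2 (h1 x))
    have h3 := congrFun hσ q
    have h4 := hg q
    simp only [Pi.sub_apply, withDegree, hcq, if_true] at h3
    push_cast at h3
    omega
  · intro hd
    refine ⟨_, fun x => ?_, G.topplingSetoid.refl _⟩
    by_cases hx : x = q
    · simp [withDegree, hx, hcq, hd]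
    · simp [withDegree, hx]

/-- An effective configuration is equivalent to one that is superstable off the sink. -/
lemma exists_isSuperstable_equiv {q : G.vertexSet} (hG : G.IsSuperstable G.edges {q} 0)
    {g : G.Configuration} (hg : G.IsEffective g) :
    ∃ c, G.IsSuperstable G.edges {q} c ∧
      G.topplingSetoid (G.withDegree q (G.configDegree g) c) g := by
  classical
  -- Only finitely many effective configurations have a given degree, and `σ q = 0` makes `topple`
  -- injective, so a `σ` with maximal sum exists. A set `W` that could still fire would increase
  -- that sum.
  have hfin : {σ : G.vertexSet → ℤ | σ q = 0 ∧ G.IsEffective (g - G.topple σ)}.Finite := by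
    refine Set.Finite.of_finite_image (f := fun σ => g - G.topple σ)
      ((finite_isEffective (G.configDegree g)).subset ?_) ?_
    · rintro _ ⟨σ, ⟨-, h⟩, rfl⟩
      refine ⟨h, ?_⟩
      simp [configDegree, sum_topple]
    · intro σ hσ τ hτ h
      exact eq_of_topple_eq hG (sub_right_injective h) (hσ.1.trans hτ.1.symm)
  obtain ⟨σ, ⟨hσq, hσ⟩, hmax⟩ := Set.exists_max_image _ (fun σ => ∑ x, σ x) hfin
    ⟨0, rfl, by rwa [topple_zero, sub_zero]⟩
  set f := g - G.topple σ with hf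
  have hfd : G.configDegree f = G.configDegree g := by
    simp [hf, configDegree, sum_topple]
  refine ⟨fun x => if x = q then 0 else (f x).toNat, ⟨by simp, fun W hW hWq => ?_⟩, ?_⟩
  · by_contra! hout
    have hqW : q ∉ W := fun h => hWq q h (by simp)
    have h1 := hmax (σ + fun x => if x ∈ W then 1 else 0) ⟨by simp [hσq, hqW], fun x => ?_⟩
    · simp only [Pi.add_apply, Finset.sum_add_distrib, Finset.sum_boole] at h1
      obtain ⟨w, hw⟩ := hW
      have : 0 < (Finset.univ.filter (· ∈ W)).card :=
        Finset.card_pos.2 ⟨w, by simpa using hw⟩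
      omega
    · rw [topple_add, ← sub_sub, ← hf, Pi.sub_apply, sub_nonneg]
      refine (topple_indicator_le W x).trans ?_
      split_ifs with hx
      · have h2 := hout x hx
        rw [if_neg (by rintro rfl; exact hqW hx)] at h2
        have := hσ x
        omega
      · exact hσ x
  · have hfx : ∀ x, ((f x).toNat : ℤ) = f x := fun x => Int.toNat_of_nonneg (hσ x)
    have : G.withDegree q (G.configDegree g) (fun x => if x = q then 0 else (f x).toNat) = f := by
      have hsum : ∑ x, (((if x = q then 0 else (f x).toNat : ℕ)) : ℤ) = G.configDegree g - f q := by
        rw [← hfd, configDegree, ← Finset.add_sum_erase _ _ (Finset.mem_univ q),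
          ← Finset.add_sum_erase _ f (Finset.mem_univ q), if_pos rfl, Nat.cast_zero, zero_add,
          add_sub_cancel_left]
        exact Finset.sum_congr rfl fun x hx => by rw [if_neg (Finset.ne_of_mem_erase hx), hfx]
      funext x
      simp only [withDegree, hsum]
      split_ifs with hx
      · simp [hx]
      · simp [hfx]
    rw [this]
    show f - g ∈ G.laplacianLattice
    exact mem_laplacianLattice_iff.2 ⟨-σ, by rw [topple_neg, hf]; abel⟩

/-- The effective classes of degree `d` are represented by the superstable configurations of degree
at most `d`. -/
lemma bijOn_effectiveClasses {q : G.vertexSet} (hG : G.IsSuperstable G.edges {q} 0) (d : ℤ) :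
    Set.BijOn (fun c => Quotient.mk G.topplingSetoid (G.withDegree q d c))
      {c | G.IsSuperstable G.edges {q} c ∧ ∑ x, (c x : ℤ) ≤ d} (G.effectiveClasses d) := by
  refine ⟨fun c hc => ?_, fun c hc c' hc' h => ?_, ?_⟩
  · exact ⟨_, hc.1.isLatticeEffective_iff.2 hc.2, configDegree_withDegree q d c, rfl⟩
  · exact hc.1.eq_of_equiv hc'.1 (Quotient.exact h)
  · rintro _ ⟨f, ⟨g, hg, hfg⟩, rfl, rfl⟩
    obtain ⟨c, hc, he⟩ := exists_isSuperstable_equiv hG hg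
    rw [← configDegree_eq_of_equiv hfg] at he
    exact ⟨c, ⟨hc, hc.isLatticeEffective_iff.1 ⟨g, hg, he⟩⟩,
      Quotient.sound (G.topplingSetoid.trans he (G.topplingSetoid.symm hfg))⟩

end Graph
end

/-! ### Connectivity and Merino's theorem -/

noncomputable section

namespace Graph

variable {α β : Type*} {G : Graph α β}

lemma IsConnectedGraph.isSuperstable_zero [Finite G.edgeSet] (h : G.IsConnectedGraph)
    (q : G.vertexSet) : G.IsSuperstable G.edges {q} 0 := by
  refine ⟨fun _ _ => rfl, fun W ⟨w, hw⟩ hWq => ?_⟩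
  by_contra! hout
  have hclosed : ∀ z, Relation.ReflTransGen G.Adj w z → ∃ hz : z ∈ G.vertexSet, ⟨z, hz⟩ ∈ W := by
    intro z hz
    induction hz with
    | refl => exact ⟨w.2, hw⟩
    | tail _ hadj ih =>
      obtain ⟨hy, hyW⟩ := ih
      obtain ⟨e, he⟩ := hadj
      refine ⟨he.right_mem, ?_⟩
      by_contra hz
      exact (hout _ hyW).not_gt (outCount_pos_iff.2 ⟨e, mem_edges.2 he.edge_mem, _, hz, he⟩)
  obtain ⟨_, hq⟩ := hclosed q (h.2 w w.2 q q.2)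
  exact hWq q hq (by simp)

/-- Both sides say that every nonempty vertex set avoiding `q` has an edge of `A` leaving it; for
the converse, take the vertices not in the component of `q`. -/
lemma componentCount_eq_one_iff (A : Finset β) (q : G.vertexSet) :
    G.componentCount (A : Set β) = 1 ↔ G.IsSuperstable A {q} 0 := by
  rw [componentCount, Nat.card_eq_one_iff_unique]
  constructor
  · rintro ⟨hsub, -⟩
    refine ⟨fun _ _ => rfl, fun W ⟨w, hw⟩ hWq => ?_⟩
    by_contra! hout
    have hnot : ∀ u v : G.vertexSet, (∃ e ∈ (A : Set β), G.IsLink e u v) → u ∈ W → v ∈ W := by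
      rintro u v ⟨e, he, hl⟩ hu
      by_contra hv
      exact (hout u hu).not_gt (outCount_pos_iff.2 ⟨e, he, v, hv, hl⟩)
    let p : (Quot fun x y : G.vertexSet => ∃ e ∈ (A : Set β), G.IsLink e x y) → Prop :=
      Quot.lift (· ∈ W) fun u v huv => propext ⟨hnot u v huv,
        hnot v u (huv.imp fun _ h => ⟨h.1, h.2.symm⟩)⟩
    have hp : p (Quot.mk _ w) = p (Quot.mk _ q) := congrArg p (hsub.elim (Quot.mk _ w) (Quot.mk _ q))
    have hq : q ∈ W := cast hp hw
    exact hWq q hq (by simp)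
  · intro h
    refine ⟨⟨fun a b => ?_⟩, ⟨Quot.mk _ q⟩⟩
    have key : ∀ x : G.vertexSet,
        Quot.mk (fun x y : G.vertexSet => ∃ e ∈ (A : Set β), G.IsLink e x y) x = Quot.mk _ q := by
      by_contra! hne
      obtain ⟨u, hu, hlt⟩ := h.exists_lt
        {x | Quot.mk (fun x y : G.vertexSet => ∃ e ∈ (A : Set β), G.IsLink e x y) x ≠ Quot.mk _ q}
        hne (by
          intro x hx hxq
          rw [Finset.mem_singleton.1 hxq] at hx
          exact hx rfl)
      obtain ⟨e, he, x, hx, hl⟩ := outCount_pos_iff.1 hlt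
      refine hu (Eq.trans (Quot.sound ⟨e, he, hl⟩) (not_not.1 hx))
    induction a using Quot.ind with
    | mk a => induction b using Quot.ind with
      | mk b => rw [key a, key b]

variable [Fintype G.vertexSet]

lemma componentCount_pos (A : Set β) (q : G.vertexSet) : 0 < G.componentCount A := by
  have : Nonempty (Quot fun x y : G.vertexSet => ∃ e ∈ A, G.IsLink e x y) := ⟨Quot.mk _ q⟩
  exact Nat.card_pos

lemma finite_isSuperstable (R : Finset β) (B : Finset G.vertexSet) :
    {c | G.IsSuperstable R B c}.Finite := by
  classical
  refine (Set.finite_Iic fun _ : G.vertexSet => R.card).subset fun c hc x => ?_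
  have h1 := Finset.single_le_sum (f := c) (fun _ _ => Nat.zero_le _) (Finset.mem_univ x)
  have h2 := IsSuperstable.card_add_sum_le hc
  show c x ≤ R.card
  omega

open Classical in
lemma card_compl_singleton (q : G.vertexSet) :
    ({q} : Finset G.vertexSet)ᶜ.card = G.numVertices - 1 := by
  rw [Finset.card_compl, Finset.card_singleton, numVertices, ← Nat.card_coe_set_eq,
    Nat.card_eq_fintype_card]

lemma numVertices_pos (q : G.vertexSet) : 0 < G.numVertices := by
  have : Nonempty G.vertexSet := ⟨q⟩
  rw [numVertices, ← Nat.card_coe_set_eq]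
  exact Nat.card_pos

variable [Finite G.edgeSet]

lemma IsSuperstable.sum_le {q : G.vertexSet} {c : G.vertexSet → ℕ}
    (h : G.IsSuperstable G.edges {q} c) :
    ∑ x, (c x : ℤ) ≤ (G.numEdges : ℤ) - G.numVertices + 1 := by
  classical
  have h1 := h.card_add_sum_le
  rw [card_compl_singleton, card_edges] at h1
  have h2 := numVertices_pos q
  rw [← Nat.cast_sum]
  omega

/-- **Merino's theorem**: `T_G(1,y)` is the level generating function of the superstable
configurations. -/
theorem tutteAtOne_eq_sum {q : G.vertexSet} (hG : G.IsSuperstable G.edges {q} 0)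
    {S : Finset (G.vertexSet → ℕ)} (hS : ∀ c, c ∈ S ↔ G.IsSuperstable G.edges {q} c) :
    G.tutteAtOne = ∑ c ∈ S, X ^ ((G.numEdges : ℤ) - G.numVertices + 1 - ∑ x, (c x : ℤ)).toNat := by
  classical
  have hn := numVertices_pos q
  have hone : G.componentCount G.edgeSet = 1 := by
    rw [← Set.Finite.coe_toFinset (Set.toFinite G.edgeSet)]
    exact (componentCount_eq_one_iff G.edges q).2 hG
  have hne : (X - 1 : ℤ[X]) ^ (G.numVertices - 1) ≠ 0 :=
    pow_ne_zero _ (by simpa using X_sub_C_ne_zero (1 : ℤ))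
  -- The factor `(X - 1) ^ (n - 1)` turns the exponent `1 + |A| - n` of a connected `A` into `|A|`,
  -- as in `sum_isSuperstable_eq`.
  refine mul_left_cancel₀ hne ?_
  have h := sum_isSuperstable_eq (X - 1 : ℤ[X]) hS
  rw [card_compl_singleton, card_edges, sub_add_cancel] at h
  calc _ = ∑ A ∈ G.edges.powerset,
          if G.IsSuperstable A {q} 0 then (X - 1 : ℤ[X]) ^ A.card else 0 := by
        rw [tutteAtOne, tuttePolynomial, map_sum, Finset.mul_sum]
        refine Finset.sum_congr rfl fun A _ => ?_
        have hpos := componentCount_pos (A : Set β) q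
        simp only [map_mul, map_pow, map_sub, map_one, MvPolynomial.aeval_X, Matrix.cons_val_zero,
          Matrix.cons_val_one, sub_self, hone]
        split_ifs with hA
        · have hle := hA.card_add_sum_le
          rw [card_compl_singleton] at hle
          rw [(componentCount_eq_one_iff A q).2 hA, Nat.sub_self, pow_zero, one_mul, ← pow_add]
          congr 1
          omega
        · have : G.componentCount (A : Set β) ≠ 1 := mt (componentCount_eq_one_iff A q).1 hA
          -- At `x = 1` a disconnected `A` contributes a positive power of `0`.
          rw [zero_pow (by omega), zero_mul, mul_zero]
    _ = _ := by
        rw [← h]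
        congr 1
        refine Finset.sum_congr rfl fun c hc => ?_
        have := ((hS c).1 hc).sum_le
        rw [← Nat.cast_sum] at this ⊢
        congr 1
        omega

/-- Negative `k` are included: no superstable `c` exceeds degree `m - n + 1`, so both sides are `0`.
-/
lemma tutteCoeff_eq_card {q : G.vertexSet} (hG : G.IsSuperstable G.edges {q} 0)
    {S : Finset (G.vertexSet → ℕ)} (hS : ∀ c, c ∈ S ↔ G.IsSuperstable G.edges {q} c) (k : ℤ) :
    G.tutteCoeff k =
      (S.filter fun c => (G.numEdges : ℤ) - G.numVertices + 1 - ∑ x, (c x : ℤ) = k).card := by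
  have hle : ∀ c ∈ S, ∑ x, (c x : ℤ) ≤ (G.numEdges : ℤ) - G.numVertices + 1 :=
    fun c hc => ((hS c).1 hc).sum_le
  rw [tutteCoeff, Finset.card_filter, Nat.cast_sum]
  split_ifs with hk
  · rw [tutteAtOne_eq_sum hG hS, finsetSum_coeff]
    refine Finset.sum_congr rfl fun c hc => ?_
    have := hle c hc
    rw [coeff_X_pow, Nat.cast_ite, Nat.cast_one, Nat.cast_zero]
    exact if_congr (by omega) rfl rfl
  · refine (Finset.sum_eq_zero fun c hc => ?_).symm
    have := hle c hc
    rw [if_neg (by omega), Nat.cast_zero]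

end Graph
end

/-! ### Counting superstable configurations by level -/

theorem mainTheorem12 {α β : Type*} (G : Graph α β) [Fintype G.vertexSet] [Finite G.edgeSet]
    [G.Loopless] (hconn : G.IsConnectedGraph) :
    G.tutteAtOne =
        ∑ i ∈ Finset.Icc (0 : ℤ) ((G.numEdges : ℤ) - G.numVertices + 1),
          Polynomial.C (G.tutteCoeff i) * Polynomial.X ^ i.toNat ∧
      ∀ d : ℤ,
        (G.effectiveClasses d).Finite ∧
          ((G.effectiveClasses d).ncard : ℤ) =
            ∑ k ∈ Finset.Icc ((G.numEdges : ℤ) - G.numVertices + 1 - d)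
                ((G.numEdges : ℤ) - G.numVertices + 1),
              G.tutteCoeff k := by
  classical
  obtain ⟨q, hq⟩ := hconn.1
  have hG := hconn.isSuperstable_zero ⟨q, hq⟩
  have hfin := G.finite_isSuperstable G.edges {⟨q, hq⟩}
  have hS : ∀ c, c ∈ hfin.toFinset ↔ G.IsSuperstable G.edges {⟨q, hq⟩} c := fun c => by simp
  have hle : ∀ c ∈ hfin.toFinset, ∑ x, (c x : ℤ) ≤ (G.numEdges : ℤ) - G.numVertices + 1 :=
    fun c hc => ((hS c).1 hc).sum_le
  set S := hfin.toFinset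
  refine ⟨?_, fun d => ?_⟩
  · rw [Graph.tutteAtOne_eq_sum hG hS, ← Finset.sum_fiberwise_of_maps_to (s := S)
      (t := Finset.Icc (0 : ℤ) ((G.numEdges : ℤ) - G.numVertices + 1))
      (g := fun c => (G.numEdges : ℤ) - G.numVertices + 1 - ∑ x, (c x : ℤ))]
    · refine Finset.sum_congr rfl fun k _ => ?_
      rw [Graph.tutteCoeff_eq_card hG hS, Finset.sum_congr rfl fun c hc => by
        rw [(Finset.mem_filter.1 hc).2], Finset.sum_const, nsmul_eq_mul]
      simp
    · intro c hc
      have := hle c hc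
      have : 0 ≤ ∑ x, (c x : ℤ) := Finset.sum_nonneg fun x _ => Int.natCast_nonneg _
      rw [Finset.mem_Icc]
      omega
  · have hbij := Graph.bijOn_effectiveClasses hG d
    have hset : {c | G.IsSuperstable G.edges {⟨q, hq⟩} c ∧ ∑ x, (c x : ℤ) ≤ d} =
        (S.filter fun c => ∑ x, (c x : ℤ) ≤ d : Finset _) := by
      ext c
      simp [hS]
    rw [hset] at hbij
    rw [← hbij.image_eq]
    refine ⟨(Finset.finite_toSet _).image _, ?_⟩
    rw [hbij.injOn.ncard_image, Set.ncard_coe_finset, Finset.card_eq_sum_card_fiberwise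
      (f := fun c => (G.numEdges : ℤ) - G.numVertices + 1 - ∑ x, (c x : ℤ))
      (t := Finset.Icc ((G.numEdges : ℤ) - G.numVertices + 1 - d)
        ((G.numEdges : ℤ) - G.numVertices + 1)), Nat.cast_sum]
    · refine Finset.sum_congr rfl fun k hk => ?_
      rw [Graph.tutteCoeff_eq_card hG hS, Finset.filter_filter]
      rw [Finset.mem_Icc] at hk
      congr 2
      -- On the fibre over `k`, the bound `∑ c ≤ d` is automatic from `k ≥ m - n + 1 - d`.
      refine Finset.filter_congr fun c _ => ⟨fun h => h.2, fun h => ⟨by omega, h⟩⟩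
    · intro c hc
      have := (Finset.mem_filter.1 hc).2
      have : 0 ≤ ∑ x, (c x : ℤ) := Finset.sum_nonneg fun x _ => Int.natCast_nonneg _
      simp only [Finset.mem_coe, Finset.mem_Icc]
      omega
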